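/- Let $G$ be a finite group and let $V_1,\dots,V_k$ be a complete list of pairwise non-isomorphic irreducible finite-dimensional complex representations of $G$, with characters $\chi_1,\dots,\chi_k$. Let $X$ be a finite set on which $G$ acts transitively, let $\mathbb{C}X$ be the permutation representation with basis $\{e_x : x\in X\}$ and action $e_g\cdot e_x=e_{g(x)}$, let $m(V_j,\mathbb{C}X)$ be the multiplicity of $V_j$ in $\mathbb{C}X$, and let $\overline{u}_X=\frac{1}{|X|}\sum_{x\in X}e_x$. For $h=\sum_{x} h(x)e_x\in\mathbb{C}X$ put $\|h\|_{\rm TV}=\frac12\sum_{x\in X}|h(x)|$. Let $Q_1,\dots,Q_m$ be probability distributions on $G$ that are constant on conjugacy classes. Then each $Q_i$ has a unique representation $Q_i=\sum_{j=1}^k a_j^{i}\chi_j$ with $a_j^i\in\mathbb{C}$. For every $N\ge 0$ and every word $w=w_1w_2\dots w_N$ with letters $w_t\in\{1,\dots,m\}$, let $Q^{(w)}:=Q_{w_1}\ast\dots\ast Q_{w_N}$, where $(P\ast Q)(h)=\sum_{g\in G}P(hg^{-1})Q(g)$ (for the empty word $Q^{(w)}$ is the point mass at the identity), and let $q^{w}:=\sum_{g\in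 G}Q^{(w)}(g)e_g\in\mathbb{C}G$. Then for every $x_0\in X$ \[\|q^{w}\cdot e_{x_0}-\overline{u}_X\|^2_{\rm TV}\leq \frac{1}{4}\sum_{V_j\neq {\rm triv}}m(V_j,\mathbb{C} X)\,\dim(V_j)\left(\frac{|G|}{\dim(V_j)}\right)^{2N}\left|\prod_{t=1}^N a_j^{w_t}\right|^2 ,\] where the sum runs over those $j$ for which $V_j$ is not isomorphic to the trivial representation. -/

import Mathlib

namespace SwitchedWalk

universe u v w

/-- The finite family `ρ 0, …, ρ (k-1)` is a complete list of the irreducible finite-dimensional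
complex representations of `G`: each member is irreducible, distinct members are not isomorphic,
and every irreducible finite-dimensional representation is isomorphic to a member. -/
structure IsCompleteIrreps {G : Type u} [Group G] {k : ℕ} {V : Fin k → Type w}
    [∀ j, AddCommGroup (V j)] [∀ j, Module ℂ (V j)]
    (ρ : ∀ j, Representation ℂ G (V j)) : Prop where
  irreducible : ∀ j, (ρ j).IsIrreducible
  eq_of_equiv : ∀ i j, Nonempty ((ρ i).Equiv (ρ j)) → i = j
  complete : ∀ (W : Type w) [AddCommGroup W] [Module ℂ W] [FiniteDimensional ℂ W]
    (σ : Representation ℂ G W), σ.IsIrreducible → ∃ j, Nonempty (σ.Equiv (ρ j))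

/-- The multiplicity `m(V, Λ)` of an irreducible complex representation `(V, ρ)` in a
representation `(Λ, σ)`: the dimension of `Hom_G(V, Λ)`. The lemma `multiplicity_eq` below checks
that this is the exponent of `V` in a decomposition of `Λ` into irreducibles. -/
noncomputable def multiplicity {G : Type u} [Group G] {V : Type v} {W : Type w}
    [AddCommGroup V] [Module ℂ V] [AddCommGroup W] [Module ℂ W]
    (ρ : Representation ℂ G V) (σ : Representation ℂ G W) : ℕ :=
  Module.finrank ℂ (Representation.IntertwiningMap ρ σ)

/-- If `Λ ≅ ⨁ⱼ Vⱼ ^ (m j)` as representations, then `m(Vⱼ, Λ) = m j`. -/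
theorem multiplicity_eq {G : Type u} [Group G] {k : ℕ} {V : Fin k → Type w}
    [∀ j, AddCommGroup (V j)] [∀ j, Module ℂ (V j)] [∀ j, FiniteDimensional ℂ (V j)]
    {ρ : ∀ j, Representation ℂ G (V j)} (hρ : IsCompleteIrreps ρ)
    {W : Type v} [AddCommGroup W] [Module ℂ W] (σ : Representation ℂ G W) (m : Fin k → ℕ)
    (e : W ≃ₗ[ℂ] (∀ j, Fin (m j) → V j))
    (he : ∀ g x j i, e (σ g x) j i = ρ j g (e x j i)) (j : Fin k) :
    multiplicity (ρ j) σ = m j := by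
  let F : Representation.IntertwiningMap (ρ j) σ ≃ₗ[ℂ]
      (∀ l, Fin (m l) → Representation.IntertwiningMap (ρ j) (ρ l)) :=
    { toFun := fun f l i =>
        ⟨LinearMap.proj i ∘ₗ LinearMap.proj l ∘ₗ e.toLinearMap ∘ₗ f.toLinearMap, fun g => by
          ext x
          have h := congrArg e (Representation.IntertwiningMap.isIntertwining _ _ f g x)
          have h2 := congrFun (congrFun h l) i
          rw [he] at h2
          exact h2⟩
      invFun := fun f =>
        ⟨e.symm.toLinearMap ∘ₗ LinearMap.pi fun l => LinearMap.pi fun i => (f l i).toLinearMap,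
          fun g => by
            ext x
            apply e.injective
            ext l i
            simp only [LinearMap.comp_apply]
            rw [he]
            simpa using Representation.IntertwiningMap.isIntertwining _ _ (f l i) g x⟩
      map_add' := fun f g => by
        ext l i x
        exact congrFun (congrFun (map_add e (f x) (g x)) l) i
      map_smul' := fun c f => by
        ext l i x
        exact congrFun (congrFun (map_smul e c (f x)) l) i
      left_inv := fun f => by
        ext x
        apply e.injective
        ext l i
        simp
      right_inv := fun f => by
        ext l i x
        simp }
  have := hρ.irreducible
  have h0 : ∀ l, Module.finrank ℂ (Representation.IntertwiningMap (ρ j) (ρ l))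
      = if l = j then 1 else 0 := by
    intro l
    split_ifs with h
    · subst h
      simp
    · have : IsEmpty ((ρ j).Equiv (ρ l)) :=
        ⟨fun φ => h (hρ.eq_of_equiv j l ⟨φ⟩).symm⟩
      exact Module.finrank_zero_of_subsingleton
  have : ∀ l, Module.Finite ℂ (Representation.IntertwiningMap (ρ j) (ρ l)) := fun l => by
    by_cases h : l = j
    · exact Module.finite_of_finrank_pos (by rw [h0, if_pos h]; exact one_pos)
    · have : IsEmpty ((ρ j).Equiv (ρ l)) :=
        ⟨fun φ => h (hρ.eq_of_equiv j l ⟨φ⟩).symm⟩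
      infer_instance
  unfold multiplicity
  rw [F.finrank_eq, Module.finrank_pi_fintype]
  simp [Module.finrank_pi_fintype, h0]

open Classical in
/-- The indices `j` for which `V_j` is not isomorphic to the trivial representation. -/
noncomputable def nontrivialIndices {G : Type u} [Group G] {k : ℕ} {V : Fin k → Type w}
    [∀ j, AddCommGroup (V j)] [∀ j, Module ℂ (V j)]
    (ρ : ∀ j, Representation ℂ G (V j)) : Finset (Fin k) :=
  Finset.univ.filter fun j => ¬ Nonempty ((ρ j).Equiv (Representation.trivial ℂ G ℂ))

/-- Convolution of functions on a finite group: `(P ∗ Q)(h) = ∑_g P(h g⁻¹) Q(g)`. -/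
def convolve {G : Type u} [Group G] [Fintype G] (P Q : G → ℝ) (h : G) : ℝ :=
  ∑ g, P (h * g⁻¹) * Q g

open Classical in
/-- `Q^{(w)} = Q_{w_1} ∗ ⋯ ∗ Q_{w_N}`; for the empty word this is the point mass at `1`. -/
noncomputable def wordConv {G : Type u} [Group G] [Fintype G] {m N : ℕ}
    (Q : Fin m → G → ℝ) (w : Fin N → Fin m) : G → ℝ :=
  (List.ofFn fun t => Q (w t)).foldr convolve (Pi.single 1 1)

/-- The element `∑_g Q(g) e_g` of the group algebra `ℂG`. -/
noncomputable def toGroupAlgebra {G : Type u} [Fintype G] (Q : G → ℝ) : MonoidAlgebra ℂ G :=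
  ∑ g, MonoidAlgebra.single g (Q g : ℂ)

/-- The uniform distribution `(1/|X|) ∑_x e_x` as an element of `ℂX`. -/
noncomputable def uniform (X : Type v) [Fintype X] : MonoidAlgebra ℂ X :=
  ∑ x, MonoidAlgebra.single x ((Fintype.card X : ℂ)⁻¹)

/-- The total variation norm on `ℂX`: half the sum of the absolute values of the coefficients. -/
noncomputable def tvNorm {X : Type v} [Fintype X] (h : MonoidAlgebra ℂ X) : ℝ :=
  (1 / 2) * ∑ x, ‖h.coeff x‖

end SwitchedWalk

/-! Write `P` for the word's distribution and `p` for its law on `X` started at `x₀`. Cauchy–Schwarz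
bounds the left side by `(|X| ∑ p(y)² - 1) / 4`. Since `P` is a class function and the action is
transitive, `∑ p(y)²` does not depend on the starting point (`sum_transition_sq`). Hence `|X| ∑
p(y)²` is a sum over all pairs of points, which unfolds into the permutation character paired with
the autocorrelation of `P` (`sum_sum_transition_sq`).

Orthogonality of translated characters diagonalises convolution: if `P = ∑ c_j χ_j` and `d_j = dim
V_j`, the autocorrelation is `∑ |c_j|² (|G|/d_j) χ_j`. The pairing therefore equals `∑ m_j d_j
|(|G|/d_j) c_j|²`. For a word, `c_j = (d_j/|G|) (|G|/d_j)^N ∏ a_j` (`wordConv_eq`). The trivial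
representation contributes its multiplicity, at most 1 by transitivity, which the `-1` absorbs. -/

namespace SwitchedWalk
open Representation Module
open scoped ComplexOrder

/-! ### Schur's lemma and conjugation of characters. -/

section Character

variable {G : Type*} [Group G] [Fintype G] {V : Type*} [AddCommGroup V] [Module ℂ V]
  [FiniteDimensional ℂ V]

/-- The value of a complex character at `g⁻¹` is the conjugate of its value at `g`. -/
theorem character_inv (ρ : Representation ℂ G V) (g : G) :
    ρ.character g⁻¹ = star (ρ.character g) := by
  classical
  let b := finBasis ℂ V
  let M : G → Matrix (Fin (finrank ℂ V)) (Fin (finrank ℂ V)) ℂ := fun g => LinearMap.toMatrix b b (ρ g)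
  have hM : ∀ g h, M (g * h) = M g * M h := fun g h => by
    simp only [M, map_mul, Module.End.mul_eq_comp, LinearMap.toMatrix_comp b b b]
  have hM1 : M 1 = 1 := by simp [M, LinearMap.toMatrix_one]
  have htr : ∀ g, ρ.character g = (M g).trace := fun g =>
    LinearMap.trace_eq_matrix_trace ℂ b (ρ g)
  -- Averaging gives an invariant Hermitian form, positive definite because the term `h = 1` is the
  -- identity. It makes `M g⁻¹` similar to the conjugate transpose of `M g`, so their traces agree.
  let P := ∑ h, (M h).conjTranspose * M h
  have hP : P.PosDef := by
    have h1 : (∑ h ∈ Finset.univ.erase (1 : G), (M h).conjTranspose * M h).PosSemidef :=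
      Matrix.posSemidef_sum _ fun h _ => Matrix.posSemidef_conjTranspose_mul_self _
    have h2 := Matrix.PosDef.add_posSemidef
      (Matrix.PosDef.one (n := Fin (finrank ℂ V)) (R := ℂ)) h1
    have h3 : P = 1 + ∑ h ∈ Finset.univ.erase (1 : G), (M h).conjTranspose * M h := by
      simp only [P]
      rw [← Finset.add_sum_erase _ _ (Finset.mem_univ (1 : G)), hM1]
      simp
    rwa [h3]
  have hinv : (M g).conjTranspose * P = P * M g⁻¹ := by
    have h1 : (M g).conjTranspose * P * M g = P := by
      simp only [P, Finset.mul_sum, Finset.sum_mul]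
      refine Fintype.sum_equiv (Equiv.mulRight g) _ _ fun h => ?_
      simp [hM, Matrix.conjTranspose_mul, Matrix.mul_assoc]
    have h2 : M g * M g⁻¹ = 1 := by rw [← hM, mul_inv_cancel, hM1]
    calc _ = (M g).conjTranspose * P * (M g * M g⁻¹) := by rw [h2, mul_one]
      _ = (M g).conjTranspose * P * M g * M g⁻¹ := by simp only [Matrix.mul_assoc]
      _ = _ := by rw [h1]
  have hu : IsUnit P.det := (Matrix.isUnit_iff_isUnit_det _).1 hP.isUnit
  rw [htr, htr, ← Matrix.trace_conjTranspose]
  have h3 : M g⁻¹ = P⁻¹ * ((M g).conjTranspose * P) := by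
    rw [hinv, ← Matrix.mul_assoc, Matrix.nonsing_inv_mul _ hu, one_mul]
  rw [h3, Matrix.trace_mul_comm, Matrix.mul_assoc, Matrix.mul_nonsing_inv _ hu, mul_one]

/-- Schur's lemma for class functions: the operator `∑ f(g) ρ(g)` is a scalar. -/
theorem sum_smul_eq_smul_one (ρ : Representation ℂ G V) [ρ.IsIrreducible] (f : G → ℂ)
    (hf : ∀ g h, f (h * g * h⁻¹) = f g) :
    ∑ g, f g • ρ g = ((∑ g, f g * ρ.character g) / finrank ℂ V) • (1 : End ℂ V) := by
  let T : IntertwiningMap ρ ρ := ⟨∑ g, f g • ρ g, fun h => by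
    change (∑ g, f g • ρ g) * ρ h = ρ h * ∑ g, f g • ρ g
    rw [Finset.sum_mul, Finset.mul_sum]
    refine Fintype.sum_equiv (MulAut.conj h⁻¹).toEquiv _ _ fun g => ?_
    have := hf g h⁻¹
    simp only [MulEquiv.toEquiv_eq_coe, EquivLike.coe_coe, MulAut.conj_apply, smul_mul_assoc,
      mul_smul_comm, ← map_mul, this]
    congr 2
    group⟩
  obtain ⟨c, hc⟩ :=
    (IsIrreducible.algebraMap_intertwiningMap_bijective_of_isAlgClosed (ρ := ρ)).2 T
  have hT : ∑ g, f g • ρ g = c • (1 : End ℂ V) := by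
    have := congrArg IntertwiningMap.toLinearMap hc
    exact this.symm
  have hd : (finrank ℂ V : ℂ) ≠ 0 := by
    have := IsSimpleModule.nontrivial (MonoidAlgebra ℂ G) ρ.asModule
    have : Nontrivial V := this
    exact_mod_cast finrank_pos.ne'
  -- Taking traces identifies Schur's scalar.
  have htr := congrArg (LinearMap.trace ℂ V) hT
  simp only [map_sum, map_smul, smul_eq_mul, LinearMap.trace_one] at htr
  rw [hT]
  congr 1
  rw [eq_div_iff hd, ← htr]
  rfl

omit [Fintype G] in
theorem finrank_ne_zero_of_isIrreducible (ρ : Representation ℂ G V) [ρ.IsIrreducible] :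
    finrank ℂ V ≠ 0 := by
  have : Nontrivial V := IsSimpleModule.nontrivial (MonoidAlgebra ℂ G) ρ.asModule
  exact finrank_pos.ne'

/-- A class function acts on an irreducible character by a scalar. -/
theorem sum_mul_character_mul (ρ : Representation ℂ G V) [ρ.IsIrreducible] (f : G → ℂ)
    (hf : ∀ g h, f (h * g * h⁻¹) = f g) (h : G) :
    ∑ g, f g * ρ.character (h * g) =
      (∑ g, f g * ρ.character g) / finrank ℂ V * ρ.character h := by
  have := congrArg (fun T => LinearMap.trace ℂ V (ρ h * T)) (sum_smul_eq_smul_one ρ f hf)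
  simpa [Finset.mul_sum, ← map_mul, character] using this

end Character

/-! ### Irreducible characters as a basis of the class functions. -/

section Irreps

universe u w

variable {G : Type u} [Group G] [Fintype G] {k : ℕ} {V : Fin k → Type w}
    [∀ j, AddCommGroup (V j)] [∀ j, Module ℂ (V j)]
    {ρ : ∀ j, Representation ℂ G (V j)}

omit [Fintype G] in
/-- Completeness of a list of irreducibles does not depend on the universe. -/
theorem IsCompleteIrreps.exists_equiv (hρ : IsCompleteIrreps ρ) {W : Type*} [AddCommGroup W]
    [Module ℂ W] [FiniteDimensional ℂ W] (σ : Representation ℂ G W) (hσ : σ.IsIrreducible) :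
    ∃ j, Nonempty (σ.Equiv (ρ j)) := by
  let e : W ≃ₗ[ℂ] ULift.{w} (Fin (finrank ℂ W) → ℂ) :=
    (finBasis ℂ W).equivFun.trans ULift.moduleEquiv.symm
  let τ : Representation ℂ G (ULift.{w} (Fin (finrank ℂ W) → ℂ)) :=
    { toFun := fun g => e.conj (σ g)
      map_one' := by simp [End.one_eq_id]
      map_mul' := fun g h => by simp [Module.End.mul_eq_comp, LinearEquiv.conj_comp] }
  let φ : σ.Equiv τ := Representation.Equiv.mk e fun g => by
    ext x
    simp [τ]
  have hτ : τ.IsIrreducible := by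
    rw [irreducible_iff_isSimpleModule_asModule] at hσ ⊢
    exact IsSimpleModule.congr (LinearEquiv.ofBijective
      (IntertwiningMap.equivLinearMapAsModule τ σ φ.symm.toIntertwiningMap) φ.symm.bijective)
  obtain ⟨j, ⟨ψ⟩⟩ := hρ.complete _ τ hτ
  exact ⟨j, ⟨φ.trans ψ⟩⟩

omit [Fintype G] in
theorem ofModule'_asAlgebraHom_apply (M : Type*) [AddCommGroup M] [Module ℂ M]
    [Module (MonoidAlgebra ℂ G) M] [IsScalarTower ℂ (MonoidAlgebra ℂ G) M]
    (y : MonoidAlgebra ℂ G) (m : M) :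
    (ofModule' (k := ℂ) (G := G) M).asAlgebraHom y m = y • m := by
  simp [ofModule', asAlgebraHom_def]

-- Turns simple submodules of the group algebra into representations to which completeness of the
-- list applies.
omit [Fintype G] in
theorem isIrreducible_ofModule' (M : Type*) [AddCommGroup M] [Module ℂ M]
    [Module (MonoidAlgebra ℂ G) M] [IsScalarTower ℂ (MonoidAlgebra ℂ G) M]
    [IsSimpleModule (MonoidAlgebra ℂ G) M] :
    (ofModule' (k := ℂ) (G := G) M).IsIrreducible := by
  rw [irreducible_iff_isSimpleModule_asModule]
  refine IsSimpleModule.congr (N := M)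
    { (ofModule' (k := ℂ) (G := G) M).asModuleEquiv.toAddEquiv with
      map_smul' := fun r x => ?_ }
  exact ofModule'_asAlgebraHom_apply M r _

/-- A class function orthogonal to all irreducible characters vanishes. -/
theorem IsCompleteIrreps.eq_zero_of_sum_mul_character (hρ : IsCompleteIrreps ρ) (f : G → ℂ)
    (hf : ∀ g h, f (h * g * h⁻¹) = f g) (h0 : ∀ j, ∑ g, f g * (ρ j).character g = 0) :
    f = 0 := by
  classical
  -- By Schur, `y` acts as zero on every irreducible. As `y` is central, its annihilator `K` is a
  -- left ideal; it contains all simple left ideals, which span by Maschke's theorem, so `y * 1 =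
  -- 0`.
  let y : MonoidAlgebra ℂ G := ∑ g, MonoidAlgebra.single g (f g)
  have hy : ∀ {W : Type u} [AddCommGroup W] [Module ℂ W] [FiniteDimensional ℂ W]
      (σ : Representation ℂ G W), σ.IsIrreducible → σ.asAlgebraHom y = 0 := by
    intro W _ _ _ σ hσ
    obtain ⟨j, ⟨φ⟩⟩ := hρ.exists_equiv σ hσ
    simp only [y, map_sum, asAlgebraHom_single]
    rw [sum_smul_eq_smul_one σ f hf, char_iso φ, h0 j]
    simp
  have hc : ∀ z, y * z = z * y := by
    intro z
    induction z using MonoidAlgebra.induction_linear with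
    | zero => simp
    | add a b ha hb => rw [mul_add, add_mul, ha, hb]
    | single h r =>
      simp only [y, Finset.sum_mul, Finset.mul_sum, MonoidAlgebra.single_mul_single]
      refine Fintype.sum_equiv (MulAut.conj h⁻¹).toEquiv _ _ fun g => ?_
      have := hf g h⁻¹
      simp only [MulEquiv.toEquiv_eq_coe, EquivLike.coe_coe, MulAut.conj_apply, this, mul_comm r]
      congr 1
      group
  let K : Submodule (MonoidAlgebra ℂ G) (MonoidAlgebra ℂ G) :=
    { carrier := {z | y * z = 0}
      zero_mem' := mul_zero y
      add_mem' := fun {a b} ha hb => by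
        simp only [Set.mem_ofPred_eq] at *
        rw [mul_add, ha, hb, add_zero]
      smul_mem' := fun a z hz => by
        simp only [Set.mem_ofPred_eq, smul_eq_mul] at *
        rw [← mul_assoc, hc, mul_assoc, hz, mul_zero] }
  have hK : K = ⊤ := by
    rw [eq_top_iff, ← IsSemisimpleModule.sSup_simples_eq_top]
    refine sSup_le fun S hS z hz => ?_
    have hS' : IsSimpleModule (MonoidAlgebra ℂ G) S := hS
    have : FiniteDimensional ℂ S := Module.Finite.trans (MonoidAlgebra ℂ G) S
    have h1 := ofModule'_asAlgebraHom_apply (G := G) S y ⟨z, hz⟩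
    rw [hy _ (isIrreducible_ofModule' S)] at h1
    exact (congrArg Subtype.val h1).symm
  have h1 : y * 1 = 0 := (hK ▸ Submodule.mem_top : (1 : MonoidAlgebra ℂ G) ∈ K)
  rw [mul_one] at h1
  ext g
  have := congrArg (fun z => z.coeff g) h1
  simpa [y, MonoidAlgebra.coeff_sum, Finsupp.single_apply] using this

variable [∀ j, FiniteDimensional ℂ (V j)]

theorem IsCompleteIrreps.sum_character_mul (hρ : IsCompleteIrreps ρ) (i j : Fin k) :
    ∑ g, (ρ i).character g * (ρ j).character g⁻¹ = if i = j then (Fintype.card G : ℂ) else 0 := by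
  have := hρ.irreducible
  have hG : (Nat.card G : ℂ) ≠ 0 := by simp
  let _ : Invertible (Nat.card G : ℂ) := invertibleOfNonzero hG
  have h := char_orthonormal (ρ i) (ρ j)
  have h2 : Nonempty ((ρ j).Equiv (ρ i)) ↔ i = j :=
    ⟨fun h => (hρ.eq_of_equiv _ _ h).symm, fun h => h ▸ ⟨.refl _⟩⟩
  rw [inv_mul_eq_iff_eq_mul₀ hG] at h
  simp only [h2] at h
  rw [h]
  simp

/-- Orthogonality of the translates of irreducible characters. -/
theorem IsCompleteIrreps.sum_character_mul_left (hρ : IsCompleteIrreps ρ) (i j : Fin k) (s : G) :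
    ∑ g, (ρ i).character (s * g) * (ρ j).character g⁻¹ =
      if i = j then (Fintype.card G : ℂ) / finrank ℂ (V i) * (ρ i).character s else 0 := by
  have := hρ.irreducible
  have h := sum_mul_character_mul (ρ i) (fun g => (ρ j).character g⁻¹)
    (fun g h => by
      simp only [mul_inv_rev, inv_inv, ← mul_assoc]
      exact char_conj (ρ j) g⁻¹ h) s
  simp only [mul_comm ((ρ j).character _)] at h
  rw [h, hρ.sum_character_mul]
  split_ifs <;> simp

theorem IsCompleteIrreps.coeff_eq (hρ : IsCompleteIrreps ρ) {f : G → ℂ} {a : Fin k → ℂ}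
    (h : ∀ g, f g = ∑ j, a j * (ρ j).character g) (j : Fin k) :
    a j = (∑ g, f g * (ρ j).character g⁻¹) / Fintype.card G := by
  have hG : (Fintype.card G : ℂ) ≠ 0 := by simp
  rw [eq_div_iff hG]
  simp only [h, Finset.sum_mul, mul_assoc]
  rw [Finset.sum_comm]
  simp [← Finset.mul_sum, hρ.sum_character_mul]

/-- Class functions are uniquely linear combinations of irreducible characters. -/
theorem IsCompleteIrreps.existsUnique_coeff (hρ : IsCompleteIrreps ρ) (f : G → ℂ)
    (hf : ∀ g h, f (h * g * h⁻¹) = f g) :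
    ∃! a : Fin k → ℂ, ∀ g, f g = ∑ j, a j * (ρ j).character g := by
  have hG : (Fintype.card G : ℂ) ≠ 0 := by simp
  refine ⟨fun j => (∑ g, f g * (ρ j).character g⁻¹) / Fintype.card G, ?_,
    fun a ha => funext (hρ.coeff_eq ha)⟩
  set a : Fin k → ℂ := fun j => (∑ g, f g * (ρ j).character g⁻¹) / Fintype.card G with ha
  -- The residual is composed with inversion because the vanishing criterion pairs with `χ_j(g)`,
  -- whereas the coefficients pair with `χ_j(g⁻¹)`.
  have key := hρ.eq_zero_of_sum_mul_character
    (fun g => f g⁻¹ - ∑ j, a j * (ρ j).character g⁻¹) (fun g h => by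
      have h1 : (h * g * h⁻¹)⁻¹ = h * g⁻¹ * h⁻¹ := by group
      simp only [h1, hf, char_conj]) (fun j => by
      simp only [sub_mul, Finset.sum_sub_distrib, Finset.sum_mul, mul_assoc]
      rw [Finset.sum_comm, sub_eq_zero]
      simp only [← Finset.mul_sum]
      rw [← Equiv.sum_comp (Equiv.inv G)]
      have h2 : ∀ i, ∑ g, (ρ i).character g⁻¹ * (ρ j).character g =
          if i = j then (Fintype.card G : ℂ) else 0 := fun i => by
        rw [← hρ.sum_character_mul, ← Equiv.sum_comp (Equiv.inv G)]
        simp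
      simp [h2, ha, hG])
  intro g
  have := congrFun key g⁻¹
  simpa [sub_eq_zero] using this

end Irreps

/-! ### The permutation character and multiplicities in `ℂX`. -/

section Permutation

variable {G : Type*} [Group G] [Fintype G] {X : Type*} [Fintype X] [MulAction G X]

omit [Fintype G] in
/-- The permutation character counts fixed points. -/
theorem character_ofMulAction [DecidableEq X] (g : G) :
    (ofMulAction ℂ G X).character g = ∑ x : X, if g • x = x then (1 : ℂ) else 0 := by
  let b : Basis X ℂ (MonoidAlgebra ℂ X) := Basis.ofRepr (MonoidAlgebra.coeffLinearEquiv ℂ)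
  rw [character, LinearMap.trace_eq_matrix_trace ℂ b, Matrix.trace]
  refine Finset.sum_congr rfl fun x _ => ?_
  have hb : b x = MonoidAlgebra.single x 1 := by
    apply b.repr.injective
    rw [b.repr_self]
    rfl
  rw [Matrix.diag_apply, LinearMap.toMatrix_apply, hb, ofMulAction_single]
  change (MonoidAlgebra.single (g • x) (1 : ℂ)).coeff x = _
  rw [MonoidAlgebra.coeff_single, Finsupp.single_apply]

omit [Fintype G] in
theorem character_ofMulAction_inv (g : G) :
    (ofMulAction ℂ G X).character g⁻¹ = (ofMulAction ℂ G X).character g := by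
  classical
  rw [character_ofMulAction, character_ofMulAction]
  refine Finset.sum_congr rfl fun x _ => ?_
  simp only [inv_smul_eq_iff, eq_comm (a := x)]

/-- The inverse in the usual inner product of characters disappears because the permutation
character is invariant under inversion. -/
theorem multiplicity_mul_card {V : Type*} [AddCommGroup V] [Module ℂ V]
    [FiniteDimensional ℂ V] (ρ : Representation ℂ G V) :
    ∑ g, (ofMulAction ℂ G X).character g * ρ.character g =
      Fintype.card G * multiplicity ρ (ofMulAction ℂ G X) := by
  have hG : (Nat.card G : ℂ) ≠ 0 := by simp
  let _ : Invertible (Nat.card G : ℂ) := invertibleOfNonzero hG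
  have h := card_inv_mul_sum_char_mul_char_eq_finrank ρ (ofMulAction ℂ G X)
  rw [inv_mul_eq_iff_eq_mul₀ hG] at h
  rw [multiplicity, ← Nat.card_eq_fintype_card, ← h, ← _root_.Equiv.sum_comp (_root_.Equiv.inv G)]
  simp [character_ofMulAction_inv]

omit [Fintype G] [Fintype X] in
/-- The trivial representation occurs at most once in a transitive permutation representation. -/
theorem multiplicity_trivial_le_one [MulAction.IsPretransitive G X] [Nonempty X] {V : Type*}
    [AddCommGroup V] [Module ℂ V] (ρ : Representation ℂ G V)
    (φ : ρ.Equiv (trivial ℂ G ℂ)) : multiplicity ρ (ofMulAction ℂ G X) ≤ 1 := by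
  let x₀ : X := Classical.arbitrary X
  let v := φ.symm 1
  have hv : ∀ g, ρ g v = v := fun g => by
    apply φ.injective
    have := IntertwiningMap.isIntertwining _ _ φ.toIntertwiningMap g v
    simpa using this
  have hspan : ∀ u, u = φ u • v := fun u => by
    apply φ.injective
    simp [v]
  let T : IntertwiningMap ρ (ofMulAction ℂ G X) →ₗ[ℂ] ℂ :=
    { toFun := fun f => (f v).coeff x₀
      map_add' := fun f g => by simp
      map_smul' := fun c f => by simp }
  -- An intertwiner is determined by the image of `v`, a `G`-invariant vector. By transitivity its
  -- coefficients are constant, so the one at `x₀` determines it.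
  have hT : Function.Injective T := by
    rw [← LinearMap.ker_eq_bot, LinearMap.ker_eq_bot']
    intro f hf
    have h0 : f v = 0 := by
      ext x
      obtain ⟨g, rfl⟩ := MulAction.exists_smul_eq G x₀ x
      have h1 := IntertwiningMap.isIntertwining _ _ f g⁻¹ v
      rw [hv] at h1
      have h2 : (f v).coeff x₀ = ((ofMulAction ℂ G X) g⁻¹ (f v)).coeff x₀ := by rw [← h1]
      rw [coeff_ofMulAction, inv_inv] at h2
      exact h2.symm.trans hf
    apply IntertwiningMap.ext
    ext u : 1
    change f u = 0
    rw [hspan u, map_smul, h0, smul_zero]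
  simpa [multiplicity] using LinearMap.finrank_le_finrank_of_injective hT

end Permutation

/-! ### Convolution in character coordinates. -/

section Coefficients

variable {G : Type*} [Group G] [Fintype G] {k : ℕ} {V : Fin k → Type*}
    [∀ j, AddCommGroup (V j)] [∀ j, Module ℂ (V j)] [∀ j, FiniteDimensional ℂ (V j)]
    {ρ : ∀ j, Representation ℂ G (V j)}

/-- Cross terms vanish by orthogonality. This serves both convolution and the autocorrelation in
Parseval's identity. -/
theorem IsCompleteIrreps.sum_mul_left (hρ : IsCompleteIrreps ρ) (a b : Fin k → ℂ) (s : G) :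
    ∑ g, (∑ i, a i * (ρ i).character (s * g)) * (∑ j, b j * (ρ j).character g⁻¹) =
      ∑ j, a j * b j * (Fintype.card G / finrank ℂ (V j)) * (ρ j).character s := by
  have h : ∀ g, (∑ i, a i * (ρ i).character (s * g)) * (∑ j, b j * (ρ j).character g⁻¹) =
      ∑ i, ∑ j, a i * b j * ((ρ i).character (s * g) * (ρ j).character g⁻¹) := fun g => by
    rw [Finset.sum_mul_sum]
    exact Finset.sum_congr rfl fun i _ => Finset.sum_congr rfl fun j _ => by ring
  simp only [h]
  rw [Finset.sum_comm]
  refine Finset.sum_congr rfl fun i _ => ?_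
  rw [Finset.sum_comm]
  simp only [← Finset.mul_sum, hρ.sum_character_mul_left, mul_ite, mul_zero, Finset.sum_ite_eq,
    Finset.mem_univ, if_true]
  ring

theorem IsCompleteIrreps.convolve_eq (hρ : IsCompleteIrreps ρ) {P R : G → ℝ} {a b : Fin k → ℂ}
    (ha : ∀ g, (P g : ℂ) = ∑ j, a j * (ρ j).character g)
    (hb : ∀ g, (R g : ℂ) = ∑ j, b j * (ρ j).character g) (g : G) :
    (convolve P R g : ℂ) =
      ∑ j, a j * b j * (Fintype.card G / finrank ℂ (V j)) * (ρ j).character g := by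
  rw [← hρ.sum_mul_left, ← _root_.Equiv.sum_comp (_root_.Equiv.inv G)]
  simp [convolve, ha, hb]

-- The point mass is the regular character divided by `|G|`.
open Classical in
theorem IsCompleteIrreps.single_one_eq (hρ : IsCompleteIrreps ρ) (g : G) :
    (((Pi.single 1 1 : G → ℝ) g : ℝ) : ℂ) =
      ∑ j, (finrank ℂ (V j) : ℂ) / Fintype.card G * (ρ j).character g := by
  have hs : ∀ g, (((Pi.single 1 1 : G → ℝ) g : ℝ) : ℂ) = if g = 1 then 1 else 0 := fun g => by
    simp only [Pi.single_apply]
    split_ifs <;> simp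
  obtain ⟨a, ha, -⟩ := hρ.existsUnique_coeff (fun g => (((Pi.single 1 1 : G → ℝ) g : ℝ) : ℂ))
    (fun g h => by simp only [hs, conj_eq_one_iff])
  have := hρ.coeff_eq ha
  simp only [hs, ite_mul, one_mul, zero_mul, Finset.sum_ite_eq', Finset.mem_univ, if_true,
    inv_one, char_one] at this
  rw [ha]
  simp only [this]

/-- The character coefficients of a convolution word. -/
theorem IsCompleteIrreps.wordConv_eq (hρ : IsCompleteIrreps ρ) {m : ℕ} (Q : Fin m → G → ℝ)
    (a : Fin m → Fin k → ℂ) (ha : ∀ i g, (Q i g : ℂ) = ∑ j, a i j * (ρ j).character g)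
    {N : ℕ} (w : Fin N → Fin m) (g : G) :
    (wordConv Q w g : ℂ) = ∑ j, (finrank ℂ (V j) : ℂ) / Fintype.card G *
      ((Fintype.card G : ℂ) / finrank ℂ (V j)) ^ N * (∏ t, a (w t) j) * (ρ j).character g := by
  induction N generalizing g with
  | zero => simpa [wordConv] using hρ.single_one_eq g
  | succ N ih =>
    have h : wordConv Q w = convolve (Q (w 0)) (wordConv Q fun t => w t.succ) := by
      simp [wordConv, List.ofFn_succ]
    rw [h, hρ.convolve_eq (ha _) (ih _)]
    refine Finset.sum_congr rfl fun j _ => ?_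
    rw [Fin.prod_univ_succ]
    ring

theorem sum_convolve (P R : G → ℝ) : ∑ h, convolve P R h = (∑ g, P g) * ∑ g, R g := by
  simp only [convolve]
  rw [Finset.sum_comm, Finset.mul_sum]
  refine Finset.sum_congr rfl fun g _ => ?_
  rw [← Finset.sum_mul, ← _root_.Equiv.sum_comp (_root_.Equiv.mulRight g⁻¹) P]
  rfl

theorem sum_wordConv {m N : ℕ} (Q : Fin m → G → ℝ) (hQ : ∀ i, ∑ g, Q i g = 1)
    (w : Fin N → Fin m) : ∑ g, wordConv Q w g = 1 := by
  classical
  induction N with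
  | zero => simp [wordConv, Pi.single_apply]
  | succ N ih =>
    have h : wordConv Q w = convolve (Q (w 0)) (wordConv Q fun t => w t.succ) := by
      simp [wordConv, List.ofFn_succ]
    rw [h, sum_convolve, hQ, ih, one_mul]

end Coefficients

/-! ### The induced walk on `X`. -/

section Walk

variable {G : Type*} [Group G] [Fintype G] {X : Type*} [Fintype X] [DecidableEq X] [MulAction G X]

/-- The probability that a `Q`-distributed group element moves `x` to `y`. -/
def transition (Q : G → ℝ) (x y : X) : ℝ := ∑ g : G, if g • x = y then Q g else 0

omit [Fintype X] in
theorem coeff_toGroupAlgebra_smul (Q : G → ℝ) (x y : X) :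
    ((ofMulAction ℂ G X).asAlgebraHom (toGroupAlgebra Q) (MonoidAlgebra.single x 1)).coeff y =
      (transition Q x y : ℂ) := by
  simp only [toGroupAlgebra, map_sum, asAlgebraHom_single, LinearMap.sum_apply,
    LinearMap.smul_apply, ofMulAction_single, MonoidAlgebra.coeff_sum, transition]
  rw [Finsupp.finsetSum_apply]
  push_cast
  refine Finset.sum_congr rfl fun g _ => ?_
  by_cases h : g • x = y <;> simp [h]

theorem sum_transition (Q : G → ℝ) (x : X) : ∑ y, transition Q x y = ∑ g, Q g := by
  simp only [transition]
  rw [Finset.sum_comm]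
  refine Finset.sum_congr rfl fun g _ => ?_
  rw [Finset.sum_ite_eq, if_pos (Finset.mem_univ _)]

omit [Fintype X] in
theorem transition_smul (Q : G → ℝ) (hQ : ∀ g h, Q (h * g * h⁻¹) = Q g) (h : G) (x y : X) :
    transition Q (h • x) (h • y) = transition Q x y := by
  refine (Fintype.sum_equiv (MulAut.conj h).toEquiv _ _ fun g => ?_).symm
  have h1 : (h * g * h⁻¹) • h • x = h • g • x := by simp [mul_smul]
  simp only [MulEquiv.toEquiv_eq_coe, EquivLike.coe_coe, MulAut.conj_apply, h1, hQ]
  exact if_congr (smul_left_cancel_iff h).symm rfl rfl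

/-- Conjugation invariance makes the transition probabilities `G`-invariant, so all starting points
give the same sum. -/
theorem sum_transition_sq [MulAction.IsPretransitive G X] (Q : G → ℝ)
    (hQ : ∀ g h, Q (h * g * h⁻¹) = Q g) (x : X) :
    Fintype.card X * ∑ y, transition Q x y ^ 2 = ∑ z, ∑ y, transition Q (z : X) (y : X) ^ 2 := by
  have h : ∀ z : X, ∑ y, transition Q z y ^ 2 = ∑ y, transition Q x y ^ 2 := by
    intro z
    obtain ⟨g, rfl⟩ := MulAction.exists_smul_eq G x z
    rw [← _root_.Equiv.sum_comp (MulAction.toPerm g)]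
    simp [transition_smul Q hQ]
  simp [h]

/-- Two elements send `z` to the same point exactly when they are `h * s` and `h` with `s` fixing
`z`. Summing over `z` first counts the fixed points of `s`. -/
theorem sum_sum_transition_sq (Q : G → ℝ) :
    ((∑ z : X, ∑ y : X, transition Q z y ^ 2 : ℝ) : ℂ) =
      ∑ s, (ofMulAction ℂ G X).character s * ∑ h, (Q (h * s) : ℂ) * Q h := by
  have h1 : ∀ (z : X) (h : G),
      transition Q z (h • z) = ∑ s : G, if s • z = z then Q (h * s) else 0 := fun z h => by
    refine (Fintype.sum_equiv (_root_.Equiv.mulLeft h) _ _ fun s => ?_).symm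
    simp only [_root_.Equiv.coe_mulLeft, mul_smul, smul_left_cancel_iff]
  have h2 : ∀ z : X, ∑ y : X, transition Q z y ^ 2 = ∑ h, transition Q z (h • z) * Q h := by
    intro z
    have h3 : ∀ y, transition Q z y ^ 2 =
        ∑ h : G, if h • z = y then transition Q z y * Q h else 0 := fun y => by
      rw [sq]
      nth_rw 2 [transition]
      rw [Finset.mul_sum]
      simp only [mul_ite, mul_zero]
    simp only [h3]
    rw [Finset.sum_comm]
    refine Finset.sum_congr rfl fun h _ => ?_
    rw [Finset.sum_ite_eq, if_pos (Finset.mem_univ _)]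
  simp only [h2, h1, character_ofMulAction, Finset.sum_mul, Finset.mul_sum]
  push_cast
  trans ∑ z : X, ∑ s : G, ∑ h : G, ((if s • z = z then Q (h * s) else 0 : ℝ) : ℂ) * Q h
  · exact Finset.sum_congr rfl fun z _ => Finset.sum_comm
  rw [Finset.sum_comm]
  refine Finset.sum_congr rfl fun s _ => ?_
  rw [Finset.sum_comm]
  refine Finset.sum_congr rfl fun z _ => Finset.sum_congr rfl fun h _ => ?_
  split_ifs <;> simp

omit [DecidableEq X] in
/-- Cauchy–Schwarz bound for the total variation distance to the uniform distribution. -/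
theorem tvNorm_sub_uniform_sq_le [Nonempty X] (f : MonoidAlgebra ℂ X) (p : X → ℝ)
    (hf : ∀ x, f.coeff x = p x) (hp : ∑ x, p x = 1) :
    tvNorm (f - uniform X) ^ 2 ≤ 1 / 4 * (Fintype.card X * ∑ x, p x ^ 2 - 1) := by
  classical
  have hX : (Fintype.card X : ℝ) ≠ 0 := by simp
  have h1 : ∀ x, ‖(f - uniform X).coeff x‖ = |p x - (Fintype.card X : ℝ)⁻¹| := fun x => by
    have : (f - uniform X).coeff x = ((p x - (Fintype.card X : ℝ)⁻¹ : ℝ) : ℂ) := by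
      simp [uniform, MonoidAlgebra.coeff_sum, Finsupp.single_apply, hf]
    rw [this, Complex.norm_real, Real.norm_eq_abs]
  have h2 := sq_sum_le_card_mul_sum_sq (s := (Finset.univ : Finset X))
    (f := fun x => |p x - (Fintype.card X : ℝ)⁻¹|)
  have h3 : ∑ x, |p x - (Fintype.card X : ℝ)⁻¹| ^ 2 =
      ∑ x, p x ^ 2 - (Fintype.card X : ℝ)⁻¹ := by
    simp only [sq_abs, sub_sq, Finset.sum_add_distrib, Finset.sum_sub_distrib, ← Finset.sum_mul,
      ← Finset.mul_sum, hp, Finset.sum_const, Finset.card_univ, nsmul_eq_mul]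
    field_simp
    ring
  rw [h3, mul_sub, Finset.card_univ, mul_inv_cancel₀ hX] at h2
  simp only [tvNorm, h1, mul_pow]
  linarith

end Walk

/-! ### Parseval's identity and the trivial coefficient. -/

section Bound

variable {G : Type*} [Group G] [Fintype G] {k : ℕ} {V : Fin k → Type*}
    [∀ j, AddCommGroup (V j)] [∀ j, Module ℂ (V j)] [∀ j, FiniteDimensional ℂ (V j)]
    {ρ : ∀ j, Representation ℂ G (V j)} {X : Type*} [Fintype X] [MulAction G X]

/-- Parseval's identity for the transition probabilities of a class function. -/
theorem IsCompleteIrreps.sum_sum_transition_sq (hρ : IsCompleteIrreps ρ) [DecidableEq X]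
    {P : G → ℝ} {c : Fin k → ℂ} (hc : ∀ g, (P g : ℂ) = ∑ j, c j * (ρ j).character g) :
    ∑ z : X, ∑ y : X, transition P z y ^ 2 =
      ∑ j, (multiplicity (ρ j) (ofMulAction ℂ G X) : ℝ) * finrank ℂ (V j) *
        ‖(Fintype.card G : ℂ) / finrank ℂ (V j) * c j‖ ^ 2 := by
  -- Since `P` is real, conjugating its expansion is harmless; pairing the two expansions produces
  -- `|c j|²`.
  have hstar : ∀ g, (P g : ℂ) = ∑ j, star (c j) * (ρ j).character g⁻¹ := fun g => by
    have := congrArg star (hc g)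
    simpa [character_inv] using this
  have h1 : ∀ s, ∑ h, (P (h * s) : ℂ) * P h =
      ∑ j, c j * star (c j) * (Fintype.card G / finrank ℂ (V j)) * (ρ j).character s := fun s => by
    rw [← hρ.sum_mul_left]
    refine Finset.sum_congr rfl fun h _ => ?_
    rw [hc (h * s), hstar h]
    simp only [char_mul_comm]
  apply Complex.ofReal_injective
  rw [SwitchedWalk.sum_sum_transition_sq]
  simp only [h1, Finset.mul_sum]
  rw [Finset.sum_comm]
  push_cast
  refine Finset.sum_congr rfl fun j _ => ?_
  have := hρ.irreducible j
  have hd : (finrank ℂ (V j) : ℂ) ≠ 0 :=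
    Nat.cast_ne_zero.2 (finrank_ne_zero_of_isIrreducible (ρ j))
  have h2 : ∀ s, (ofMulAction ℂ G X).character s * (c j * star (c j) *
      (Fintype.card G / finrank ℂ (V j)) * (ρ j).character s) = c j * star (c j) *
      (Fintype.card G / finrank ℂ (V j)) *
      ((ofMulAction ℂ G X).character s * (ρ j).character s) := fun s => by ring
  simp only [h2]
  rw [← Finset.mul_sum, multiplicity_mul_card, ← Complex.mul_conj']
  simp only [map_mul, map_div₀, Complex.conj_natCast, Complex.star_def]
  field_simp

theorem IsCompleteIrreps.coeff_of_equiv_trivial (hρ : IsCompleteIrreps ρ) {P : G → ℝ}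
    {c : Fin k → ℂ} (hc : ∀ g, (P g : ℂ) = ∑ j, c j * (ρ j).character g) (hP : ∑ g, P g = 1)
    {j : Fin k} (φ : (ρ j).Equiv (trivial ℂ G ℂ)) : c j = (Fintype.card G : ℂ)⁻¹ := by
  have h1 : ∀ g, (ρ j).character g = 1 := fun g => by
    rw [char_iso φ]
    simp [character]
  have h2 : (∑ g, (P g : ℂ)) = 1 := by exact_mod_cast hP
  rw [hρ.coeff_eq hc j]
  simp [h1, h2]

end Bound

end SwitchedWalk

theorem mainTheorem7 {G : Type*} [Group G] [Fintype G]
    {k : ℕ} {V : Fin k → Type*} [∀ j, AddCommGroup (V j)] [∀ j, Module ℂ (V j)]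
    [∀ j, FiniteDimensional ℂ (V j)]
    (ρ : ∀ j, Representation ℂ G (V j)) (hρ : SwitchedWalk.IsCompleteIrreps ρ)
    {X : Type*} [Fintype X] [MulAction G X] [MulAction.IsPretransitive G X]
    {m : ℕ} (Q : Fin m → G → ℝ) (hQ : ∀ i, Q i ∈ stdSimplex ℝ G)
    (hconj : ∀ i g h, IsConj g h → Q i g = Q i h) :
    (∀ i, ∃! a : Fin k → ℂ, ∀ g, (Q i g : ℂ) = ∑ j, a j * (ρ j).character g) ∧
    ∀ a : Fin m → Fin k → ℂ,
      (∀ i g, (Q i g : ℂ) = ∑ j, a i j * (ρ j).character g) →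
      ∀ (N : ℕ) (w : Fin N → Fin m) (x₀ : X),
        SwitchedWalk.tvNorm
            ((Representation.ofMulAction ℂ G X).asAlgebraHom
                (SwitchedWalk.toGroupAlgebra (SwitchedWalk.wordConv Q w))
                (MonoidAlgebra.single x₀ 1)
              - SwitchedWalk.uniform X) ^ 2
          ≤ (1 / 4) * ∑ j ∈ SwitchedWalk.nontrivialIndices ρ,
              (SwitchedWalk.multiplicity (ρ j) (Representation.ofMulAction ℂ G X) : ℝ)
                * (Module.finrank ℂ (V j) : ℝ)
                * ((Fintype.card G : ℝ) / (Module.finrank ℂ (V j) : ℝ)) ^ (2 * N)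
                * ‖∏ t, a (w t) j‖ ^ 2 := by
  have hclass : ∀ i g h, Q i (h * g * h⁻¹) = Q i g := fun i g h =>
    (hconj i _ _ (isConj_iff.2 ⟨h, rfl⟩)).symm
  refine ⟨fun i => hρ.existsUnique_coeff (fun g => (Q i g : ℂ)) fun g h => by simp only [hclass],
    fun a ha N w x₀ => ?_⟩
  classical
  have : Nonempty X := ⟨x₀⟩
  have hsum : ∀ i, ∑ g, Q i g = 1 := fun i => (hQ i).2
  have hc := hρ.wordConv_eq Q a ha w
  have hWclass : ∀ g h, SwitchedWalk.wordConv Q w (h * g * h⁻¹) = SwitchedWalk.wordConv Q w g := by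
    intro g h
    apply Complex.ofReal_injective
    simp only [hc, Representation.char_conj]
  refine (SwitchedWalk.tvNorm_sub_uniform_sq_le _ _
    (SwitchedWalk.coeff_toGroupAlgebra_smul (SwitchedWalk.wordConv Q w) x₀)
    ((SwitchedWalk.sum_transition _ _).trans (SwitchedWalk.sum_wordConv Q hsum w))).trans ?_
  rw [SwitchedWalk.sum_transition_sq _ hWclass, hρ.sum_sum_transition_sq hc]
  refine mul_le_mul_of_nonneg_left ?_ (by norm_num)
  have hG : (Fintype.card G : ℂ) ≠ 0 := by simp
  -- Parseval's factor `|G|/d_j` cancels the `d_j/|G|` coming from the point mass of the empty word.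
  have hB : ∀ j, ‖(Fintype.card G : ℂ) / Module.finrank ℂ (V j) *
      ((Module.finrank ℂ (V j) : ℂ) / Fintype.card G *
        ((Fintype.card G : ℂ) / Module.finrank ℂ (V j)) ^ N * ∏ t, a (w t) j)‖ ^ 2 =
      ((Fintype.card G : ℝ) / (Module.finrank ℂ (V j) : ℝ)) ^ (2 * N) *
        ‖∏ t, a (w t) j‖ ^ 2 := fun j => by
    have := hρ.irreducible j
    have hd : (Module.finrank ℂ (V j) : ℂ) ≠ 0 :=
      Nat.cast_ne_zero.2 (SwitchedWalk.finrank_ne_zero_of_isIrreducible (ρ j))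
    rw [← mul_assoc, ← mul_assoc, div_mul_div_cancel₀ hd, div_self hG, one_mul, norm_mul, mul_pow,
      norm_pow, norm_div, Complex.norm_natCast, Complex.norm_natCast, ← pow_mul, mul_comm N]
  simp only [hB]
  simp only [← mul_assoc]
  rw [← Finset.sum_filter_add_sum_filter_not Finset.univ
    (fun j => ¬ Nonempty ((ρ j).Equiv (Representation.trivial ℂ G ℂ)))]
  have hset : SwitchedWalk.nontrivialIndices ρ = Finset.univ.filter
      (fun j => ¬ Nonempty ((ρ j).Equiv (Representation.trivial ℂ G ℂ))) := by
    ext j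
    simp [SwitchedWalk.nontrivialIndices]
  -- Once the nontrivial terms cancel, the trivial contribution must be at most 1.
  rw [← hset, add_sub_assoc, add_le_iff_nonpos_right, sub_nonpos]
  simp only [not_not]
  by_cases htriv : ∃ j, Nonempty ((ρ j).Equiv (Representation.trivial ℂ G ℂ))
  · obtain ⟨j, ⟨φ⟩⟩ := htriv
    have hfil : Finset.univ.filter
        (fun i => Nonempty ((ρ i).Equiv (Representation.trivial ℂ G ℂ))) = {j} := by
      ext i
      simp only [Finset.mem_filter, Finset.mem_univ, true_and, Finset.mem_singleton]
      exact ⟨fun ⟨ψ⟩ => hρ.eq_of_equiv i j ⟨ψ.trans φ.symm⟩, fun h => h ▸ ⟨φ⟩⟩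
    have hd : Module.finrank ℂ (V j) = 1 := by
      rw [φ.toLinearEquiv.finrank_eq, Module.finrank_self]
    have hm : (SwitchedWalk.multiplicity (ρ j) (Representation.ofMulAction ℂ G X) : ℝ) ≤ 1 := by
      exact_mod_cast SwitchedWalk.multiplicity_trivial_le_one (ρ j) φ
    have ha1 : ∀ i, a i j = (Fintype.card G : ℂ)⁻¹ := fun i =>
      hρ.coeff_of_equiv_trivial (ha i) (hsum i) φ
    have hGr : (Fintype.card G : ℝ) ≠ 0 := by simp
    rw [hfil, Finset.sum_singleton, hd]
    simp only [ha1, Finset.prod_const, Finset.card_univ, Fintype.card_fin, norm_pow, norm_inv,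
      Complex.norm_natCast, Nat.cast_one, mul_one, div_one]
    -- With dimension 1 and every coefficient `1/|G|`, the powers of `|G|` cancel and only the
    -- multiplicity remains.
    rw [← pow_mul, mul_comm N, mul_assoc, ← mul_pow, mul_inv_cancel₀ hGr, one_pow, mul_one]
    exact hm
  -- Existence of a trivial member is not needed: without one the leftover sum is empty.
  · rw [Finset.filter_false_of_mem fun j _ hj => htriv ⟨j, hj⟩]
    simp
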